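/- For $\lambda\in\mathbb{C}$ let the Gegenbauer polynomials $C_n^\lambda(x)$ be defined by $\sum_{n\ge 0} C_n^\lambda(x)\,t^n=(1-2xt+t^2)^{-\lambda}$ as formal power series in $t$, and let $(a)_n=a(a+1)\cdots(a+n-1)$. (1) Let $x$ be a number, real or complex, with $|x|>1$, and let $\sqrt{x^2-1}$ be either square root of $x^2-1$. Put $R=(1-2xt+t^2)^{1/2}$, with $R=1$ at $t=0$, and define $\xi$ by $$e^{\xi}=R^{-1}\left[1-\left(x-\sqrt{x^2-1}\right)t\right],$$ with $\xi=0$ at $t=0$. Then, as an equality between power series in $t$, $$\sum_{n=0}^\infty \frac{(-1/12)_n}{(1/2)_n}\,C_n^{1/4}(x)\,t^n = 2^{-1/4}R^{1/12}\left[\cosh(\xi/3)+\sqrt{\frac{\sinh\xi}{3\sinh(\xi/3)}}\,\right]^{1/4},$$ where all roots are principal. That is, there is $r>0$, depending on $x$, such that for all complex $t$ with $0<|t|<r$ one has $\sinh(\xi/3)\neq0$, and the series on the left converges to the right-hand side (which has a removable singularity at $t=0$). (2) The generating function on the left is algebraic: as an element of $\mathbb{C}[x][[t]]$, it is a root of a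 nonzero polynomial in one variable with coefficients in $\mathbb{C}[x,t]$. -/

import Mathlib

noncomputable section

/-- The Pochhammer symbol `(a)_n = a (a + 1) ⋯ (a + n - 1)`. -/
def pochhammerC (a : ℂ) (n : ℕ) : ℂ := (ascPochhammer ℂ n).eval a

/-- The formal power series `-2 x t + t ^ 2` in `t`, with coefficients in `ℂ[x]`. -/
def gegenbauerArg : PowerSeries (Polynomial ℂ) :=
  PowerSeries.X ^ 2 - PowerSeries.C (2 * Polynomial.X) * PowerSeries.X

/-- `gegenbauerArg` has no constant term, so it may be substituted into any power series. -/
theorem hasSubst_gegenbauerArg : PowerSeries.HasSubst gegenbauerArg := by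
  apply PowerSeries.HasSubst.of_constantCoeff_zero'
  simp [gegenbauerArg]

/-- The ordinary generating function `(1 - 2 x t + t ^ 2) ^ (-lam)` of the Gegenbauer
polynomials, as a formal power series in `t` over `ℂ[x]`: the binomial series
`(1 + u) ^ (-lam)` with `u = -2 x t + t ^ 2` substituted. -/
def gegenbauerSeries (lam : ℂ) : PowerSeries (Polynomial ℂ) :=
  (PowerSeries.binomialSeries (Polynomial ℂ) (-lam)).subst gegenbauerArg

/-- The Gegenbauer polynomial `C_n^lam(x)`: the coefficient of `t ^ n` in
`(1 - 2 x t + t ^ 2) ^ (-lam)`. -/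
def gegenbauerPoly (lam : ℂ) (n : ℕ) : Polynomial ℂ :=
  PowerSeries.coeff n (gegenbauerSeries lam)

/-- The coefficient `(-1/12)_n / (1/2)_n`. -/
def octaCoeff (n : ℕ) : ℂ := pochhammerC (-1 / 12) n / pochhammerC (1 / 2) n

/-- The generating function `∑ (-1/12)_n / (1/2)_n * C_n^{1/4}(x) * t ^ n`, as a formal power
series in `t` over `ℂ[x]`. -/
def octaSeries : PowerSeries (Polynomial ℂ) :=
  PowerSeries.mk fun n => Polynomial.C (octaCoeff n) * gegenbauerPoly (1 / 4) n

/-- `R = (1 - 2 x t + t ^ 2) ^ (1/2)`, principal branch; so `R = 1` at `t = 0`. -/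
def octaR (x t : ℂ) : ℂ := (1 - 2 * x * t + t ^ 2) ^ (1 / 2 : ℂ)

/-- `ξ`, defined by `e ^ ξ = R⁻¹ * (1 - (x - s) * t)`, principal branch, so that `ξ = 0` at
`t = 0`. Here `s` stands for a square root of `x ^ 2 - 1`. -/
def octaXi (x s t : ℂ) : ℂ := Complex.log ((octaR x t)⁻¹ * (1 - (x - s) * t))

/-- The closed form
`2^(-1/4) * R^(1/12) * (cosh (ξ/3) + √(sinh ξ / (3 * sinh (ξ/3)))) ^ (1/4)`, all roots being
principal. At `t = 0` one has `ξ = 0`, a removable singularity of the quotient of hyperbolic sines. -/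
def octaClosedForm (x s t : ℂ) : ℂ :=
  (2 : ℂ) ^ (-1 / 4 : ℂ) * octaR x t ^ (1 / 12 : ℂ) *
    (Complex.cosh (octaXi x s t / 3) +
      (Complex.sinh (octaXi x s t) / (3 * Complex.sinh (octaXi x s t / 3))) ^ (1 / 2 : ℂ))
        ^ (1 / 4 : ℂ)

end

/-!
Write `Q = 1 - 2 x t + t ^ 2`, so that `R ^ 2 = Q`, and `u = ξ / 3`.

The three-term recurrence of the Gegenbauer polynomials turns into a recurrence for the
coefficients of the generating function, that is, into a second-order linear differential equation
in `t` (`eq_map_octaSeries`). Its exponents at `t = 0` are `0` and `1 / 2`, so it has only one formal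
solution with constant term `1`. Part (1) therefore amounts to the closed form being
analytic at `t = 0`, with value `1` there, and satisfying the same equation.

Analyticity follows from the triple angle formula, by which
`sinh ξ / (3 * sinh u) = 1 + (4 / 3) * sinh u ^ 2`; this defines `octaFun`, the closed form with its
singularity removed. For the equation one uses `ξ' = s / Q`, `R * sinh ξ = s * t` and
`R * cosh ξ = 1 - x * t`. The logarithmic derivative of `octaFun` is rational in `t`, `sinh u`,
`cosh u` and `w = √(1 + (4 / 3) * sinh u ^ 2)`, and the equation reduces to a Riccati equation in the
variable `u` (`OctaRegular.octaSlope_riccati`), which is a polynomial identity modulo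
`cosh u ^ 2 = 1 + sinh u ^ 2` and `3 * w ^ 2 = 3 + 4 * sinh u ^ 2`.

For part (2), put `y = R ^ (1 / 3) * (cosh u + w)`, which is twice the fourth power of the closed
form, and `c = R ^ (1 / 3) * cosh u`. Then `1 - x * t = c ^ 3 - 18 * y * c ^ 2 + 9 * y ^ 2 * c` and
`Q = (c ^ 2 + 6 * y * c - 3 * y ^ 2) ^ 3`. Eliminating `c` leaves a polynomial relation between `Q`,
`1 - x * t` and `y ^ 3` with integer coefficients (`octaRelation`). It holds for the Taylor series at
`0` of the closed form for every complex `x`, hence for the generating function over `ℂ[x]`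
(`octaRelation_octaSeries`).
-/

open Filter Topology
open scoped Nat

noncomputable section

/-! ### Taylor series at zero as a ring homomorphism -/

/-- The functions `ℂ → ℂ` that are analytic at `0`. -/
def analyticAtZero : Subalgebra ℂ (ℂ → ℂ) where
  carrier := {f | AnalyticAt ℂ f 0}
  mul_mem' hf hg := AnalyticAt.mul hf hg
  add_mem' hf hg := AnalyticAt.add hf hg
  algebraMap_mem' _ := analyticAt_const

/-- The Taylor series at `0`, as a homomorphism from functions analytic at `0` to formal power
series. -/
def taylorAtZero : analyticAtZero →ₐ[ℂ] PowerSeries ℂ where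
  toFun f := PowerSeries.mk fun n => (n ! : ℂ)⁻¹ * iteratedDeriv n (f : ℂ → ℂ) 0
  map_one' := by
    ext n
    have : ((1 : analyticAtZero) : ℂ → ℂ) = fun _ => 1 := rfl
    rw [PowerSeries.coeff_mk, this, iteratedDeriv_const, PowerSeries.coeff_one]
    split_ifs with h <;> simp [h]
  map_zero' := by
    ext n
    have : ((0 : analyticAtZero) : ℂ → ℂ) = fun _ => 0 := rfl
    rw [PowerSeries.coeff_mk, this, iteratedDeriv_const]
    simp
  map_add' f g := by
    ext n
    have : ((f + g : analyticAtZero) : ℂ → ℂ) = (f : ℂ → ℂ) + g := rfl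
    rw [map_add, PowerSeries.coeff_mk, PowerSeries.coeff_mk, PowerSeries.coeff_mk, this,
      iteratedDeriv_add f.2.contDiffAt g.2.contDiffAt, mul_add]
  map_mul' f g := by
    ext n
    have : ((f * g : analyticAtZero) : ℂ → ℂ) = (f : ℂ → ℂ) * g := rfl
    rw [PowerSeries.coeff_mk, this, iteratedDeriv_mul f.2.contDiffAt g.2.contDiffAt,
      PowerSeries.coeff_mul, Finset.Nat.sum_antidiagonal_eq_sum_range_succ_mk, Finset.mul_sum]
    refine Finset.sum_congr rfl fun k hk => ?_
    have hk : k ≤ n := Nat.lt_succ_iff.mp (Finset.mem_range.mp hk)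
    have hn : (n ! : ℂ) ≠ 0 := mod_cast n.factorial_ne_zero
    have hk' : (k ! : ℂ) ≠ 0 := mod_cast k.factorial_ne_zero
    have hd : ((n - k)! : ℂ) ≠ 0 := mod_cast (n - k).factorial_ne_zero
    rw [PowerSeries.coeff_mk, PowerSeries.coeff_mk, Nat.cast_choose ℂ hk]
    field_simp
  commutes' a := by
    ext n
    have : ((algebraMap ℂ analyticAtZero a : analyticAtZero) : ℂ → ℂ) = fun _ => a := rfl
    rw [PowerSeries.coeff_mk, this, iteratedDeriv_const, PowerSeries.algebraMap_apply,
      PowerSeries.coeff_C]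
    split_ifs with h <;> simp [h]

theorem coeff_taylorAtZero (f : analyticAtZero) (n : ℕ) :
    PowerSeries.coeff n (taylorAtZero f) = (n ! : ℂ)⁻¹ * iteratedDeriv n (f : ℂ → ℂ) 0 :=
  PowerSeries.coeff_mk n fun n => (n ! : ℂ)⁻¹ * iteratedDeriv n (f : ℂ → ℂ) 0

theorem taylorAtZero_congr {f g : analyticAtZero} (h : (f : ℂ → ℂ) =ᶠ[𝓝 0] g) :
    taylorAtZero f = taylorAtZero g := by
  ext n
  rw [coeff_taylorAtZero, coeff_taylorAtZero, h.iteratedDeriv_eq]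

theorem taylorAtZero_deriv {f g : analyticAtZero} (h : (g : ℂ → ℂ) =ᶠ[𝓝 0] deriv f) :
    taylorAtZero g = PowerSeries.derivative ℂ (taylorAtZero f) := by
  ext n
  rw [PowerSeries.coeff_derivative, coeff_taylorAtZero, coeff_taylorAtZero, h.iteratedDeriv_eq,
    iteratedDeriv_succ', Nat.factorial_succ, Nat.cast_mul, mul_inv, Nat.cast_succ]
  field_simp [Nat.cast_add_one_ne_zero (R := ℂ) n]

/-- The function `t ↦ t`. -/
def idAtZero : analyticAtZero := ⟨fun t => t, analyticAt_id⟩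

theorem taylorAtZero_id : taylorAtZero idAtZero = PowerSeries.X := by
  ext n
  rw [coeff_taylorAtZero, PowerSeries.coeff_X]
  have : (idAtZero : ℂ → ℂ) = fun t => t := rfl
  rw [this, iteratedDeriv_fun_id_zero]
  split_ifs with h <;> simp [h]

/-- A function analytic at `0` is the sum of its Taylor series near `0`. -/
theorem exists_hasSum_taylorAtZero (f : analyticAtZero) :
    ∃ r : ℝ, 0 < r ∧ ∀ t : ℂ, ‖t‖ < r →
      HasSum (fun n => PowerSeries.coeff n (taylorAtZero f) * t ^ n) ((f : ℂ → ℂ) t) := by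
  obtain ⟨r, hr, h⟩ := Metric.eventually_nhds_iff_ball.mp f.2.eventually_analyticAt
  refine ⟨r, hr, fun t ht => ?_⟩
  have hd : DifferentiableOn ℂ (f : ℂ → ℂ) (Metric.ball 0 r) :=
    fun z hz => (h z hz).differentiableAt.differentiableWithinAt
  refine (Complex.hasSum_taylorSeries_on_ball hd (mem_ball_zero_iff.mpr ht)).congr_fun ?_
  intro n
  rw [coeff_taylorAtZero, sub_zero, smul_eq_mul, smul_eq_mul]
  ring

/-! ### The Gegenbauer recurrence and the differential equation -/

open PowerSeries in
/-- The binomial series `B = (1 + X) ^ r` satisfies `(1 + X) * B' = r * B`. -/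
theorem one_add_X_mul_derivative_binomialSeries (r : ℂ) :
    (1 + X) * derivative (Polynomial ℂ) (binomialSeries (Polynomial ℂ) r) =
      PowerSeries.C (Polynomial.C r) * binomialSeries (Polynomial ℂ) r := by
  have key (n : ℕ) : ((n : ℂ) + 1) * Ring.choose r (n + 1) = (r - n) * Ring.choose r n := by
    have h := Ring.choose_smul_choose r (n := n + 1) (k := n) (Nat.le_succ n)
    rw [Nat.choose_succ_self_right, Nat.add_sub_cancel_left, Ring.choose_one_right] at h
    rw [nsmul_eq_mul] at h
    push_cast at h
    linear_combination h
  ext1 n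
  rw [add_mul, one_mul, map_add, coeff_C_mul]
  rcases n with _ | n
  · simp [coeff_derivative, ← Polynomial.C_mul']
  · rw [coeff_succ_X_mul]
    simp only [coeff_derivative, binomialSeries_coeff, ← Polynomial.C_mul', mul_one]
    have h := congrArg Polynomial.C (key (n + 1))
    push_cast [map_mul, map_add, map_sub, map_natCast] at h ⊢
    simp only [map_one] at h
    linear_combination h

open PowerSeries in
/-- The generating function `H = (1 - 2 x t + t ^ 2) ^ (-lam)` satisfies
`(1 - 2 x t + t ^ 2) * H' = 2 * lam * (x - t) * H`. -/
theorem derivative_gegenbauerSeries (lam : ℂ) :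
    (1 - PowerSeries.C (2 * Polynomial.X) * X + X ^ 2) *
        derivative (Polynomial ℂ) (gegenbauerSeries lam) =
      PowerSeries.C (Polynomial.C (2 * lam)) * (PowerSeries.C Polynomial.X - X) *
        gegenbauerSeries lam := by
  have h := congrArg (fun f => subst gegenbauerArg f)
    (one_add_X_mul_derivative_binomialSeries (-lam))
  have hs := hasSubst_gegenbauerArg
  have h1 : (1 : PowerSeries (Polynomial ℂ)).subst gegenbauerArg =
      (1 : PowerSeries (Polynomial ℂ)) := by
    rw [← coe_substAlgHom hs, map_one]
  have hC : (PowerSeries.C (Polynomial.C (-lam))).subst gegenbauerArg =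
      (PowerSeries.C (Polynomial.C (-lam)) : PowerSeries (Polynomial ℂ)) := subst_C _
  simp only [subst_mul hs, subst_add hs, subst_X hs, h1, hC] at h
  have hd : derivative (Polynomial ℂ) gegenbauerArg =
      2 * X - PowerSeries.C (2 * Polynomial.X) := by
    simp only [gegenbauerArg, map_sub, Derivation.leibniz, derivative_pow, derivative_X,
      derivative_C, smul_eq_mul]
    norm_num
  unfold gegenbauerSeries
  rw [derivative_subst hs, hd]
  have h2 : (PowerSeries.C (2 * Polynomial.X) : PowerSeries (Polynomial ℂ)) =
      2 * PowerSeries.C Polynomial.X := by rw [map_mul]; rfl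
  have h3 : (PowerSeries.C (Polynomial.C (2 * lam)) : PowerSeries (Polynomial ℂ)) =
      2 * PowerSeries.C (Polynomial.C lam) := by rw [map_mul, map_mul]; rfl
  have h4 : (PowerSeries.C (Polynomial.C (-lam)) : PowerSeries (Polynomial ℂ)) =
      - PowerSeries.C (Polynomial.C lam) := by rw [map_neg, map_neg]
  rw [gegenbauerArg, h2] at h
  rw [h4] at h
  rw [gegenbauerArg, h3, h2]
  linear_combination (2 * X - 2 * PowerSeries.C Polynomial.X) * h

theorem gegenbauerPoly_zero (lam : ℂ) : gegenbauerPoly lam 0 = 1 := by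
  rw [gegenbauerPoly, gegenbauerSeries, PowerSeries.coeff_zero_eq_constantCoeff_apply]
  have hs := hasSubst_gegenbauerArg
  have h1 : (1 : PowerSeries (Polynomial ℂ)).subst gegenbauerArg =
      (1 : PowerSeries (Polynomial ℂ)) := by
    rw [← PowerSeries.coe_substAlgHom hs, map_one]
  obtain ⟨g, hg⟩ := PowerSeries.X_dvd_iff.mpr
    (show PowerSeries.constantCoeff (PowerSeries.binomialSeries (Polynomial ℂ) (-lam) - 1) = 0 by
      rw [map_sub, PowerSeries.binomialSeries_constantCoeff, map_one, sub_self])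
  have h0 : PowerSeries.constantCoeff gegenbauerArg = 0 := by simp [gegenbauerArg]
  rw [sub_eq_iff_eq_add.mp hg, PowerSeries.subst_add hs, PowerSeries.subst_mul hs,
    PowerSeries.subst_X hs, h1, map_add, map_mul, h0, zero_mul, zero_add, map_one]

theorem gegenbauerPoly_one (lam : ℂ) :
    gegenbauerPoly lam 1 = Polynomial.C (2 * lam) * Polynomial.X := by
  have h := congrArg (PowerSeries.coeff 0) (derivative_gegenbauerSeries lam)
  have h' := PowerSeries.coeff_derivative (gegenbauerSeries lam) 0
  rw [PowerSeries.coeff_zero_eq_constantCoeff_apply] at h'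
  simp [h'] at h
  have h0 := gegenbauerPoly_zero lam
  rw [gegenbauerPoly, PowerSeries.coeff_zero_eq_constantCoeff_apply] at h0
  rw [gegenbauerPoly, h, h0]
  simp

/-- The three-term recurrence of the Gegenbauer polynomials. -/
theorem gegenbauerPoly_add_two (lam : ℂ) (n : ℕ) (x : ℂ) :
    (n + 2) * (gegenbauerPoly lam (n + 2)).eval x =
      2 * x * (n + 1 + lam) * (gegenbauerPoly lam (n + 1)).eval x -
        (n + 2 * lam) * (gegenbauerPoly lam n).eval x := by
  have h := congrArg (PowerSeries.coeff (n + 1)) (derivative_gegenbauerSeries lam)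
  rw [add_mul, sub_mul, one_mul, mul_assoc, pow_two, mul_assoc, mul_assoc, sub_mul, map_add,
    map_sub, PowerSeries.coeff_C_mul, PowerSeries.coeff_C_mul, map_sub, PowerSeries.coeff_C_mul,
    PowerSeries.coeff_succ_X_mul, PowerSeries.coeff_succ_X_mul, PowerSeries.coeff_succ_X_mul,
    PowerSeries.coeff_derivative, PowerSeries.coeff_derivative] at h
  have h' : PowerSeries.coeff n
      (PowerSeries.X * PowerSeries.derivative (Polynomial ℂ) (gegenbauerSeries lam)) =
      n * gegenbauerPoly lam n := by
    rcases n with _ | n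
    · simp
    · rw [PowerSeries.coeff_succ_X_mul, PowerSeries.coeff_derivative, gegenbauerPoly]
      push_cast
      ring
  rw [h'] at h
  have h := congrArg (Polynomial.eval x) h
  have hc (k : ℕ) : PowerSeries.coeff k (gegenbauerSeries lam) = gegenbauerPoly lam k := rfl
  simp only [hc, Polynomial.eval_add, Polynomial.eval_sub, Polynomial.eval_mul,
    Polynomial.eval_X, Polynomial.eval_C, Polynomial.eval_natCast, Polynomial.eval_one,
    Polynomial.eval_ofNat] at h
  rw [Nat.cast_succ] at h
  linear_combination h

theorem half_add_natCast_ne_zero (n : ℕ) : (1 / 2 + n : ℂ) ≠ 0 := by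
  have h : ((1 / 2 + n : ℝ) : ℂ) ≠ 0 := Complex.ofReal_ne_zero.mpr (by positivity)
  simpa using h

theorem octaCoeff_zero : octaCoeff 0 = 1 := by
  simp [octaCoeff, pochhammerC]

theorem octaCoeff_succ (n : ℕ) :
    octaCoeff (n + 1) * (1 / 2 + n) = octaCoeff n * (-1 / 12 + n) := by
  have h1 (k : ℕ) : (ascPochhammer ℂ k).eval (1 / 2) ≠ 0 := by
    induction k with
    | zero => simp
    | succ k ih => rw [ascPochhammer_succ_eval]; exact mul_ne_zero ih (half_add_natCast_ne_zero k)
  rw [octaCoeff, octaCoeff, pochhammerC, pochhammerC, pochhammerC, pochhammerC,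
    ascPochhammer_succ_eval, ascPochhammer_succ_eval]
  have hn := half_add_natCast_ne_zero n
  have hn' := h1 n
  -- `field_simp` would rewrite `1 / 2 + n` and then not recognise that it is nonzero.
  generalize (1 / 2 + n : ℂ) = a at *
  field_simp

open PowerSeries in
theorem coeff_X_mul_derivative (f : PowerSeries ℂ) (n : ℕ) :
    coeff n (X * derivative ℂ f) = n * coeff n f := by
  rcases n with _ | n
  · simp
  · rw [coeff_succ_X_mul, coeff_derivative]
    push_cast
    ring

open PowerSeries in
theorem coeff_X_mul_X_mul_derivative (f : PowerSeries ℂ) (n : ℕ) :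
    coeff n (X * (X * derivative ℂ (derivative ℂ f))) = n * (n - 1) * coeff n f := by
  rcases n with _ | n
  · simp
  · rw [coeff_succ_X_mul, coeff_X_mul_derivative, coeff_derivative]
    push_cast
    ring

open PowerSeries in
/-- The generating function, at a fixed `x`, is the only formal solution with constant term `1` of
its second-order differential equation: the exponents of the equation at `t = 0` are `0` and
`1 / 2`. -/
theorem eq_map_octaSeries (x : ℂ) (f : PowerSeries ℂ) (h0 : constantCoeff f = 1)
    (h : X * (1 - C (2 * x) * X + X ^ 2) * derivative ℂ (derivative ℂ f) +
      (C (1 / 2) - C (7 / 3 * x) * X + C (11 / 6) * X ^ 2) * derivative ℂ f +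
      (C (x / 24) - C (11 / 144) * X) * f = 0) :
    f = map (Polynomial.evalRingHom x) octaSeries := by
  have hF (n : ℕ) : coeff n (map (Polynomial.evalRingHom x) octaSeries) =
      octaCoeff n * (gegenbauerPoly (1 / 4) n).eval x := by
    simp [octaSeries]
  have hne (n : ℕ) : ((n : ℂ) + 1) * (n + 1 / 2) ≠ 0 := by
    rw [add_comm (n : ℂ) (1 / 2)]
    exact mul_ne_zero (Nat.cast_add_one_ne_zero n) (half_add_natCast_ne_zero n)
  have hg0 : coeff 0 f = 1 := by rw [coeff_zero_eq_constantCoeff_apply, h0]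
  have hr : X * derivative ℂ (derivative ℂ f) -
      C (2 * x) * (X * (X * derivative ℂ (derivative ℂ f))) +
      X * (X * (X * derivative ℂ (derivative ℂ f))) +
      (C (1 / 2) * derivative ℂ f - C (7 / 3 * x) * (X * derivative ℂ f) +
        C (11 / 6) * (X * (X * derivative ℂ f))) +
      (C (x / 24) * f - C (11 / 144) * (X * f)) = 0 := by
    linear_combination h
  have hr0 := congrArg (coeff 0) hr
  have hrs (n : ℕ) := congrArg (coeff (n + 1)) hr
  simp only [map_add, map_sub, coeff_C_mul, coeff_zero_X_mul, coeff_succ_X_mul, map_zero,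
    coeff_X_mul_X_mul_derivative, coeff_X_mul_derivative, coeff_derivative] at hr0 hrs
  ext n
  induction n using Nat.twoStepInduction with
  | zero => rw [hF, hg0, octaCoeff_zero, gegenbauerPoly_zero]; simp
  | one =>
    have hc := octaCoeff_succ 0
    rw [octaCoeff_zero] at hc
    rw [hF, gegenbauerPoly_one]
    simp only [Polynomial.eval_mul, Polynomial.eval_C, Polynomial.eval_X]
    norm_num at hc hr0 ⊢
    rw [h0] at hr0
    linear_combination 2 * hr0 - x * hc
  | more n ih1 ih2 =>
    have hc1 := octaCoeff_succ n
    have hc2 := octaCoeff_succ (n + 1)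
    have hg := gegenbauerPoly_add_two (1 / 4) n x
    have hn := hrs n
    rw [ih1, ih2, hF, hF] at hn
    rw [hF]
    apply mul_left_cancel₀ (hne (n + 1))
    push_cast at *
    linear_combination hn - (n + 2) * (gegenbauerPoly (1 / 4) (n + 2)).eval x * hc2 -
      (n + 11 / 12) * octaCoeff (n + 1) * hg +
      (n + 11 / 12) * (gegenbauerPoly (1 / 4) n).eval x * hc1

/-! ### The closed form with its singularity removed -/

/-- The radicand `1 + (4 / 3) * sinh (ξ / 3) ^ 2`. By the triple angle formula it is
`sinh ξ / (3 * sinh (ξ / 3))` wherever `sinh (ξ / 3) ≠ 0`, and it is analytic at `t = 0`. -/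
def octaRadicand (x s t : ℂ) : ℂ := 1 + 4 / 3 * Complex.sinh (octaXi x s t / 3) ^ 2

/-- The square root of `octaRadicand`. -/
def octaRoot (x s t : ℂ) : ℂ := octaRadicand x s t ^ (1 / 2 : ℂ)

/-- The closed form with its singularity at `t = 0` removed. -/
def octaFun (x s t : ℂ) : ℂ :=
  (2 : ℂ) ^ (-1 / 4 : ℂ) * octaR x t ^ (1 / 12 : ℂ) *
    (Complex.cosh (octaXi x s t / 3) + octaRoot x s t) ^ (1 / 4 : ℂ)

/-- No branch cut is met at `t`: every base of a power or argument of a logarithm in `octaFun`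
lies in the slit plane. -/
structure OctaRegular (x s t : ℂ) : Prop where
  quad : 1 - 2 * x * t + t ^ 2 ∈ Complex.slitPlane
  root : octaR x t ∈ Complex.slitPlane
  exp : (octaR x t)⁻¹ * (1 - (x - s) * t) ∈ Complex.slitPlane
  radicand : octaRadicand x s t ∈ Complex.slitPlane
  sum : Complex.cosh (octaXi x s t / 3) + octaRoot x s t ∈ Complex.slitPlane

theorem octaR_zero (x : ℂ) : octaR x 0 = 1 := by simp [octaR]

theorem octaXi_zero (x s : ℂ) : octaXi x s 0 = 0 := by simp [octaXi, octaR_zero]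

theorem octaRadicand_zero (x s : ℂ) : octaRadicand x s 0 = 1 := by
  simp [octaRadicand, octaXi_zero]

theorem octaRoot_zero (x s : ℂ) : octaRoot x s 0 = 1 := by
  simp [octaRoot, octaRadicand_zero]

theorem octaFun_zero (x s : ℂ) : octaFun x s 0 = 1 := by
  rw [octaFun, octaR_zero, octaXi_zero, octaRoot_zero]
  norm_num
  rw [← Complex.cpow_add _ _ two_ne_zero]
  norm_num

theorem eventually_octaRegular (x s : ℂ) : ∀ᶠ t in 𝓝 0, OctaRegular x s t := by
  have ev {f : ℂ → ℂ} (hf : ContinuousAt f 0) (h : f 0 ∈ Complex.slitPlane) :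
      ∀ᶠ t in 𝓝 0, f t ∈ Complex.slitPlane :=
    hf.eventually (Complex.isOpen_slitPlane.mem_nhds h)
  have h2 : (2 : ℂ) ∈ Complex.slitPlane := by simp [Complex.slitPlane]
  have cQ : ContinuousAt (fun t : ℂ => 1 - 2 * x * t + t ^ 2) 0 := by fun_prop
  have cR : ContinuousAt (octaR x) 0 := cQ.cpow continuousAt_const (by simp)
  have cE : ContinuousAt (fun t => (octaR x t)⁻¹ * (1 - (x - s) * t)) 0 :=
    (cR.inv₀ (by simp [octaR_zero])).mul (by fun_prop)
  have cX : ContinuousAt (octaXi x s) 0 := cE.clog (by simp [octaR_zero])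
  have cW : ContinuousAt (octaRadicand x s) 0 :=
    continuousAt_const.add (continuousAt_const.mul
      ((Complex.continuous_sinh.continuousAt.comp (cX.div_const 3)).pow 2))
  have cw : ContinuousAt (octaRoot x s) 0 :=
    cW.cpow continuousAt_const (by simp [octaRadicand_zero])
  have cP : ContinuousAt (fun t => Complex.cosh (octaXi x s t / 3) + octaRoot x s t) 0 :=
    (Complex.continuous_cosh.continuousAt.comp (cX.div_const 3)).add cw
  filter_upwards [ev cQ (by simp), ev cR (by simp [octaR_zero]), ev cE (by simp [octaR_zero]),
    ev cW (by simp [octaRadicand_zero]),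
    ev cP (by norm_num [octaXi_zero, octaRoot_zero, h2])] with t h1 h2 h3 h4 h5
  exact ⟨h1, h2, h3, h4, h5⟩

theorem sq_cpow_half (z : ℂ) : (z ^ (1 / 2 : ℂ)) ^ 2 = z := by
  rw [← Complex.cpow_nat_mul]
  norm_num

theorem octaR_sq (x t : ℂ) : octaR x t ^ 2 = 1 - 2 * x * t + t ^ 2 := sq_cpow_half _

theorem octaRoot_sq (x s t : ℂ) : octaRoot x s t ^ 2 = octaRadicand x s t := sq_cpow_half _

namespace OctaRegular

variable {x s t : ℂ}

theorem octaR_ne_zero (h : OctaRegular x s t) : octaR x t ≠ 0 := Complex.slitPlane_ne_zero h.root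

theorem octaRoot_ne_zero (h : OctaRegular x s t) : octaRoot x s t ≠ 0 := fun h0 =>
  Complex.slitPlane_ne_zero h.radicand (by rw [← octaRoot_sq, h0]; simp)

theorem sum_ne_zero (h : OctaRegular x s t) :
    Complex.cosh (octaXi x s t / 3) + octaRoot x s t ≠ 0 :=
  Complex.slitPlane_ne_zero h.sum

theorem exp_octaXi (h : OctaRegular x s t) :
    Complex.exp (octaXi x s t) = (octaR x t)⁻¹ * (1 - (x - s) * t) :=
  Complex.exp_log (Complex.slitPlane_ne_zero h.exp)

theorem factor_mul_factor (hs : s ^ 2 = x ^ 2 - 1) :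
    (1 - (x - s) * t) * (1 - (x + s) * t) = octaR x t ^ 2 := by
  rw [octaR_sq]
  linear_combination -t ^ 2 * hs

theorem exp_neg_octaXi (h : OctaRegular x s t) (hs : s ^ 2 = x ^ 2 - 1) :
    Complex.exp (-octaXi x s t) = (octaR x t)⁻¹ * (1 - (x + s) * t) := by
  have hR := h.octaR_ne_zero
  rw [Complex.exp_neg, h.exp_octaXi]
  apply inv_eq_of_mul_eq_one_right
  have hA : 1 - (x - s) * t ≠ 0 := right_ne_zero_of_mul (Complex.slitPlane_ne_zero h.exp)
  have h1 := factor_mul_factor (t := t) hs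
  have hB : 1 - (x + s) * t ≠ 0 := fun h0 => hR (by rw [h0, mul_zero] at h1; simpa using h1.symm)
  field_simp
  linear_combination h1

/-- `R * sinh ξ = s * t`, in terms of `ξ / 3`. -/
theorem octaR_mul_sinh (h : OctaRegular x s t) (hs : s ^ 2 = x ^ 2 - 1) :
    octaR x t * (4 * Complex.sinh (octaXi x s t / 3) ^ 3 + 3 * Complex.sinh (octaXi x s t / 3)) =
      s * t := by
  have hR := h.octaR_ne_zero
  rw [← Complex.sinh_three_mul, mul_div_cancel₀ _ three_ne_zero, Complex.sinh,
    h.exp_octaXi, h.exp_neg_octaXi hs]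
  field_simp
  ring

/-- `R * cosh ξ = 1 - x * t`, in terms of `ξ / 3`. -/
theorem octaR_mul_cosh (h : OctaRegular x s t) (hs : s ^ 2 = x ^ 2 - 1) :
    octaR x t * (4 * Complex.cosh (octaXi x s t / 3) ^ 3 - 3 * Complex.cosh (octaXi x s t / 3)) =
      1 - x * t := by
  have hR := h.octaR_ne_zero
  rw [← Complex.cosh_three_mul, mul_div_cancel₀ _ three_ne_zero, Complex.cosh,
    h.exp_octaXi, h.exp_neg_octaXi hs]
  field_simp
  ring

end OctaRegular

/-! ### Derivatives and the Riccati equation -/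

/-- A power with constant exponent has logarithmic derivative `c * f' / f`. -/
theorem HasDerivAt.cpow_const_logDeriv {f : ℂ → ℂ} {l t : ℂ} (c : ℂ)
    (hf : HasDerivAt f (l * f t) t) (h : f t ∈ Complex.slitPlane) :
    HasDerivAt (fun z => f z ^ c) (c * l * f t ^ c) t := by
  have h0 := Complex.slitPlane_ne_zero h
  refine HasDerivAt.congr_deriv (hf.cpow_const (c := c) h) ?_
  rw [Complex.cpow_sub _ _ h0, Complex.cpow_one]
  field_simp

namespace OctaRegular

variable {x s t : ℂ}

theorem hasDerivAt_octaR (h : OctaRegular x s t) :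
    HasDerivAt (octaR x) ((t - x) / octaR x t ^ 2 * octaR x t) t := by
  have hq : HasDerivAt (fun t : ℂ => 1 - 2 * x * t + t ^ 2)
      ((2 * (t - x) / octaR x t ^ 2) * (1 - 2 * x * t + t ^ 2)) t := by
    have hR := h.octaR_ne_zero
    rw [← octaR_sq, div_mul_cancel₀ _ (pow_ne_zero 2 hR)]
    refine HasDerivAt.congr_deriv ((((hasDerivAt_id t).const_mul (2 * x)).const_sub 1).add
      ((hasDerivAt_id t).pow 2)) ?_
    simp
    ring
  refine HasDerivAt.congr_deriv (hq.cpow_const_logDeriv (1 / 2) h.quad) ?_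
  rw [octaR]
  ring

theorem hasDerivAt_octaXi (h : OctaRegular x s t) (hs : s ^ 2 = x ^ 2 - 1) :
    HasDerivAt (octaXi x s) (s / octaR x t ^ 2) t := by
  have hR := h.octaR_ne_zero
  have hA : 1 - (x - s) * t ≠ 0 := right_ne_zero_of_mul (Complex.slitPlane_ne_zero h.exp)
  have h1 : HasDerivAt (fun t => (octaR x t)⁻¹ * (1 - (x - s) * t)) _ t :=
    (h.hasDerivAt_octaR.inv hR).mul (((hasDerivAt_id t).const_mul (x - s)).const_sub 1)
  refine HasDerivAt.congr_deriv (h1.clog h.exp) ?_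
  have key : -(t - x) * (1 - (x - s) * t) - (x - s) * octaR x t ^ 2 = s * (1 - (x - s) * t) := by
    linear_combination (x - s) * factor_mul_factor (t := t) hs - t * (1 - (x - s) * t) * hs
  simp only [Pi.inv_apply]
  generalize 1 - (x - s) * t = A at *
  field_simp
  linear_combination key

theorem hasDerivAt_sinh (h : OctaRegular x s t) (hs : s ^ 2 = x ^ 2 - 1) :
    HasDerivAt (fun t => Complex.sinh (octaXi x s t / 3))
      (Complex.cosh (octaXi x s t / 3) * (s / octaR x t ^ 2 / 3)) t :=
  ((h.hasDerivAt_octaXi hs).div_const 3).csinh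

theorem hasDerivAt_cosh (h : OctaRegular x s t) (hs : s ^ 2 = x ^ 2 - 1) :
    HasDerivAt (fun t => Complex.cosh (octaXi x s t / 3))
      (Complex.sinh (octaXi x s t / 3) * (s / octaR x t ^ 2 / 3)) t :=
  ((h.hasDerivAt_octaXi hs).div_const 3).ccosh

theorem hasDerivAt_octaRoot (h : OctaRegular x s t) (hs : s ^ 2 = x ^ 2 - 1) :
    HasDerivAt (octaRoot x s)
      (4 * Complex.sinh (octaXi x s t / 3) * Complex.cosh (octaXi x s t / 3) /
        (3 * octaRoot x s t) * (s / octaR x t ^ 2 / 3)) t := by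
  have hw := h.octaRoot_ne_zero
  have hW : HasDerivAt (octaRadicand x s)
      ((8 / 3 * Complex.sinh (octaXi x s t / 3) * Complex.cosh (octaXi x s t / 3) *
        (s / octaR x t ^ 2 / 3) / octaRadicand x s t) * octaRadicand x s t) t := by
    rw [div_mul_cancel₀ _ (Complex.slitPlane_ne_zero h.radicand)]
    refine HasDerivAt.congr_deriv
      ((((h.hasDerivAt_sinh hs).pow 2).const_mul (4 / 3)).const_add 1) ?_
    simp
    ring
  refine HasDerivAt.congr_deriv (hW.cpow_const_logDeriv (1 / 2) h.radicand) ?_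
  rw [← octaRoot, ← octaRoot_sq]
  field_simp
  ring

end OctaRegular

/-- The logarithmic derivative of `cosh u + octaRoot` with respect to `u = ξ / 3`. -/
def octaSlope (x s t : ℂ) : ℂ :=
  Complex.sinh (octaXi x s t / 3) *
      (3 * octaRoot x s t + 4 * Complex.cosh (octaXi x s t / 3)) /
    (3 * octaRoot x s t * (Complex.cosh (octaXi x s t / 3) + octaRoot x s t))

/-- The logarithmic derivative of `octaFun` with respect to `t`. -/
def octaLogDeriv (x s t : ℂ) : ℂ := (t - x + s * octaSlope x s t) / (12 * octaR x t ^ 2)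

/-- The derivative of `octaSlope` with respect to `u = ξ / 3`, by the quotient rule. -/
def octaSlopeDeriv (x s t : ℂ) : ℂ :=
  let S := Complex.sinh (octaXi x s t / 3)
  let c := Complex.cosh (octaXi x s t / 3)
  let w := octaRoot x s t
  let w' := 4 * S * c / (3 * w)
  ((c * (3 * w + 4 * c) + S * (3 * w' + 4 * S)) * (3 * w * (c + w)) -
    S * (3 * w + 4 * c) * (3 * w' * (c + w) + 3 * w * (S + w'))) / (3 * w * (c + w)) ^ 2

namespace OctaRegular

variable {x s t : ℂ}

theorem hasDerivAt_octaFun (h : OctaRegular x s t) (hs : s ^ 2 = x ^ 2 - 1) :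
    HasDerivAt (octaFun x s) (octaLogDeriv x s t * octaFun x s t) t := by
  have hw := h.octaRoot_ne_zero
  have hP := h.sum_ne_zero
  have hR := h.octaR_ne_zero
  have h1 := (h.hasDerivAt_octaR).cpow_const_logDeriv (1 / 12) h.root
  have h2 : HasDerivAt (fun t => Complex.cosh (octaXi x s t / 3) + octaRoot x s t)
      ((octaSlope x s t * (s / octaR x t ^ 2 / 3)) *
        (Complex.cosh (octaXi x s t / 3) + octaRoot x s t)) t := by
    refine HasDerivAt.congr_deriv ((h.hasDerivAt_cosh hs).add (h.hasDerivAt_octaRoot hs)) ?_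
    rw [octaSlope]
    field_simp
  have h3 := h2.cpow_const_logDeriv (1 / 4) h.sum
  refine HasDerivAt.congr_deriv ((h1.const_mul ((2 : ℂ) ^ (-1 / 4 : ℂ))).mul h3) ?_
  rw [octaFun, octaLogDeriv]
  field_simp
  ring

theorem hasDerivAt_octaSlope (h : OctaRegular x s t) (hs : s ^ 2 = x ^ 2 - 1) :
    HasDerivAt (octaSlope x s) (octaSlopeDeriv x s t * (s / octaR x t ^ 2 / 3)) t := by
  have hw := h.octaRoot_ne_zero
  have hP := h.sum_ne_zero
  have dw := h.hasDerivAt_octaRoot hs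
  have dS := h.hasDerivAt_sinh hs
  have dc := h.hasDerivAt_cosh hs
  refine HasDerivAt.congr_deriv ((dS.mul ((dw.const_mul 3).add (dc.const_mul 4))).div
    ((dw.const_mul 3).mul (dc.add dw))
    (mul_ne_zero (mul_ne_zero three_ne_zero hw) hP)) ?_
  simp only [octaSlopeDeriv, Pi.add_apply, Pi.mul_apply]
  ring

theorem hasDerivAt_octaLogDeriv (h : OctaRegular x s t) (hs : s ^ 2 = x ^ 2 - 1) :
    HasDerivAt (octaLogDeriv x s)
      ((1 + s ^ 2 * octaSlopeDeriv x s t / (3 * octaR x t ^ 2)) / (12 * octaR x t ^ 2) -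
        (t - x) * (t - x + s * octaSlope x s t) / (6 * octaR x t ^ 4)) t := by
  have hR := h.octaR_ne_zero
  refine HasDerivAt.congr_deriv
    ((((hasDerivAt_id t).sub_const x).add ((h.hasDerivAt_octaSlope hs).const_mul s)).div
    ((h.hasDerivAt_octaR.pow 2).const_mul 12)
    (mul_ne_zero (by norm_num) (pow_ne_zero 2 hR))) ?_
  simp only [Pi.add_apply, id]
  field_simp
  ring

/-- The Riccati equation for the logarithmic derivative `N` of `cosh u + octaRoot`, namely
`4 * N' + N ^ 2 - 7 + 6 * coth (3 * u) * N = 0` with the factor `R * sinh (3 * u) = s * t` cleared, so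
that it holds at `t = 0` as well. Equivalently, `φ = (cosh u + octaRoot) ^ (1 / 4)` satisfies
`16 * φ'' + 24 * coth (3 * u) * φ' - 7 * φ = 0`. -/
theorem octaSlope_riccati (h : OctaRegular x s t) (hs : s ^ 2 = x ^ 2 - 1) :
    s * t * (4 * octaSlopeDeriv x s t + octaSlope x s t ^ 2 - 7) +
      6 * (1 - x * t) * octaSlope x s t = 0 := by
  have hw := h.octaRoot_ne_zero
  have hP := h.sum_ne_zero
  have hw2 := octaRoot_sq x s t
  have hc2 := Complex.cosh_sq (octaXi x s t / 3)
  rw [← h.octaR_mul_sinh hs, ← h.octaR_mul_cosh hs]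
  simp only [octaSlope, octaSlopeDeriv, octaRadicand] at *
  generalize Complex.sinh (octaXi x s t / 3) = S at *
  generalize Complex.cosh (octaXi x s t / 3) = c at *
  generalize octaRoot x s t = w at *
  clear h hs
  field_simp
  grind

/-- The differential equation of the generating function for `octaFun`, divided by `octaFun`: with
`L = octaLogDeriv`, the second derivative contributes `L' + L ^ 2`. -/
theorem octaFun_ode (h : OctaRegular x s t) (hs : s ^ 2 = x ^ 2 - 1) :
    t * octaR x t ^ 2 * (((1 + s ^ 2 * octaSlopeDeriv x s t / (3 * octaR x t ^ 2)) /
        (12 * octaR x t ^ 2) - (t - x) * (t - x + s * octaSlope x s t) / (6 * octaR x t ^ 4)) +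
        octaLogDeriv x s t ^ 2) +
      (1 / 2 - 7 / 3 * x * t + 11 / 6 * t ^ 2) * octaLogDeriv x s t +
      (x / 24 - 11 / 144 * t) = 0 := by
  have hR := h.octaR_ne_zero
  have hric := h.octaSlope_riccati hs
  have hR2 := octaR_sq x t
  rw [octaLogDeriv]
  generalize octaSlope x s t = N at *
  generalize octaSlopeDeriv x s t = N' at *
  generalize octaR x t = R at *
  field_simp
  grind

end OctaRegular

/-! ### Identification with the generating function -/

theorem analyticAt_octaFun {x s : ℂ} (hs : s ^ 2 = x ^ 2 - 1) : AnalyticAt ℂ (octaFun x s) 0 := by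
  rw [Complex.analyticAt_iff_eventually_differentiableAt]
  filter_upwards [eventually_octaRegular x s] with t ht
  exact (ht.hasDerivAt_octaFun hs).differentiableAt

theorem eventually_deriv_deriv_octaFun {x s : ℂ} (hs : s ^ 2 = x ^ 2 - 1) :
    ∀ᶠ t in 𝓝 0, t * (1 - 2 * x * t + t ^ 2) * deriv (deriv (octaFun x s)) t +
      (1 / 2 - 7 / 3 * x * t + 11 / 6 * t ^ 2) * deriv (octaFun x s) t +
      (x / 24 - 11 / 144 * t) * octaFun x s t = 0 := by
  filter_upwards [(eventually_octaRegular x s).eventually_nhds] with t ht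
  have h := ht.self_of_nhds
  have h1 : deriv (octaFun x s) =ᶠ[𝓝 t] fun z => octaLogDeriv x s z * octaFun x s z := by
    filter_upwards [ht] with z hz using (hz.hasDerivAt_octaFun hs).deriv
  have h2 := h1.deriv_eq.trans ((h.hasDerivAt_octaLogDeriv hs).mul (h.hasDerivAt_octaFun hs)).deriv
  rw [h2, h1.self_of_nhds, ← octaR_sq]
  linear_combination octaFun x s t * h.octaFun_ode hs

/-- The closed form with its singularity removed, as a function analytic at `0`. -/
def octaGerm (x s : ℂ) (hs : s ^ 2 = x ^ 2 - 1) : analyticAtZero :=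
  ⟨octaFun x s, analyticAt_octaFun hs⟩

/-- The Taylor series of the closed form is the generating function. -/
theorem taylorAtZero_octaGerm {x s : ℂ} (hs : s ^ 2 = x ^ 2 - 1) :
    taylorAtZero (octaGerm x s hs) = PowerSeries.map (Polynomial.evalRingHom x) octaSeries := by
  set f := octaGerm x s hs
  let f1 : analyticAtZero := ⟨deriv f, f.2.deriv⟩
  let f2 : analyticAtZero := ⟨deriv f1, f1.2.deriv⟩
  have hf1 : taylorAtZero f1 = PowerSeries.derivative ℂ (taylorAtZero f) :=
    taylorAtZero_deriv (EventuallyEq.refl _ _)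
  have hf2 : taylorAtZero f2 = PowerSeries.derivative ℂ (taylorAtZero f1) :=
    taylorAtZero_deriv (EventuallyEq.refl _ _)
  have hC (a : ℂ) : taylorAtZero (algebraMap ℂ analyticAtZero a) = PowerSeries.C a :=
    taylorAtZero.commutes a
  apply eq_map_octaSeries
  · rw [← PowerSeries.coeff_zero_eq_constantCoeff_apply, coeff_taylorAtZero]
    have h0 : (f : ℂ → ℂ) 0 = 1 := octaFun_zero x s
    simpa using h0
  · have h : taylorAtZero
        (idAtZero * (1 - algebraMap ℂ _ (2 * x) * idAtZero + idAtZero ^ 2) * f2 +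
        (algebraMap ℂ _ (1 / 2) - algebraMap ℂ _ (7 / 3 * x) * idAtZero +
          algebraMap ℂ _ (11 / 6) * idAtZero ^ 2) * f1 +
        (algebraMap ℂ _ (x / 24) - algebraMap ℂ _ (11 / 144) * idAtZero) * f) =
        taylorAtZero 0 := by
      apply taylorAtZero_congr
      filter_upwards [eventually_deriv_deriv_octaFun hs] with t ht
      exact ht
    rw [map_zero] at h
    simp only [map_add, map_sub, map_mul, map_pow, map_one, hC, taylorAtZero_id, hf2, hf1] at h
    rw [← h]
    simp only [map_mul]

theorem sinh_octaXi_div_three_ne_zero {x s t : ℂ} (hx : 1 < ‖x‖) (hs : s ^ 2 = x ^ 2 - 1)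
    (ht : t ≠ 0) (h : OctaRegular x s t) : Complex.sinh (octaXi x s t / 3) ≠ 0 := by
  intro h0
  have h1 := h.octaR_mul_sinh hs
  rw [h0] at h1
  have hs0 : s = 0 := by simpa [ht] using h1.symm
  have hx2 : x ^ 2 = 1 := by
    rw [hs0] at hs
    linear_combination -hs
  have := congrArg norm hx2
  rw [norm_pow, norm_one] at this
  nlinarith

theorem octaClosedForm_eq_octaFun {x s t : ℂ} (h : Complex.sinh (octaXi x s t / 3) ≠ 0) :
    octaClosedForm x s t = octaFun x s t := by
  have h3 : Complex.sinh (octaXi x s t) / (3 * Complex.sinh (octaXi x s t / 3)) =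
      octaRadicand x s t := by
    have := Complex.sinh_three_mul (octaXi x s t / 3)
    rw [mul_div_cancel₀ _ three_ne_zero] at this
    rw [this, octaRadicand]
    field_simp
    ring
  rw [octaClosedForm, h3, octaFun, octaRoot]

/-! ### Algebraicity -/

/-- The polynomial relation between `q = 1 - 2 x t + t ^ 2`, `k = 1 - x t` and `Y = 8 * z`, where
`z` is the twelfth power of the generating function. With `Y = y ^ 3` it is, up to a constant
factor, the resultant with respect to `c` of the two equations of
`octaRelation_parametrization`. -/
def octaRelation {A : Type*} [CommRing A] (q k Y : A) : A :=
  80621568 * Y ^ 6 - 604661760 * k * Y ^ 5 + (1511094528 * k ^ 2 - 1826022528 * q) * Y ^ 4 +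
    (1197076320 * q * k - 1256912640 * k ^ 3) * Y ^ 3 +
    (66219768 * q * k ^ 2 - 3497904 * k ^ 4 - 67741029 * q ^ 2) * Y ^ 2 -
    (3240 * k ^ 5 + 85374 * q * k ^ 3 + 68850 * q ^ 2 * k) * Y + (q - k ^ 2) ^ 3

theorem octaRelation_parametrization {A : Type*} [CommRing A] (c y : A) :
    octaRelation ((c ^ 2 + 6 * y * c - 3 * y ^ 2) ^ 3) (c ^ 3 - 18 * y * c ^ 2 + 9 * y ^ 2 * c)
      (y ^ 3) = 0 := by
  rw [octaRelation]
  ring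

theorem map_octaRelation {A B : Type*} [CommRing A] [CommRing B] (f : A →+* B) (q k Y : A) :
    f (octaRelation q k Y) = octaRelation (f q) (f k) (f Y) := by
  simp only [octaRelation, map_add, map_sub, map_mul, map_pow, map_ofNat]

/-- The closed form satisfies the relation: take `y = R ^ (1 / 3) * (cosh (ξ / 3) + octaRoot)` and
`c = R ^ (1 / 3) * cosh (ξ / 3)` in the parametrization. -/
theorem OctaRegular.octaRelation_octaFun {x s t : ℂ} (h : OctaRegular x s t)
    (hs : s ^ 2 = x ^ 2 - 1) :
    octaRelation (1 - 2 * x * t + t ^ 2) (1 - x * t) (8 * octaFun x s t ^ 12) = 0 := by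
  have hρ : (octaR x t ^ (1 / 12 : ℂ)) ^ 12 = octaR x t := by
    rw [← Complex.cpow_nat_mul]
    norm_num
  have hp : ((Complex.cosh (octaXi x s t / 3) + octaRoot x s t) ^ (1 / 4 : ℂ)) ^ 4 =
      Complex.cosh (octaXi x s t / 3) + octaRoot x s t := by
    rw [← Complex.cpow_nat_mul]
    norm_num
  have h2 : ((2 : ℂ) ^ (-1 / 4 : ℂ)) ^ 4 = 1 / 2 := by
    rw [← Complex.cpow_nat_mul]
    norm_num [Complex.cpow_neg_one]
  have hw : 3 * octaRoot x s t ^ 2 = 4 * Complex.cosh (octaXi x s t / 3) ^ 2 - 1 := by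
    rw [octaRoot_sq, octaRadicand, Complex.cosh_sq]
    ring
  have hk := h.octaR_mul_cosh hs
  rw [← octaR_sq, ← hk, octaFun]
  -- With `ρ = R ^ (1 / 12)`, the cube root `R ^ (1 / 3)` of the parametrization is `ρ ^ 4`.
  generalize Complex.cosh (octaXi x s t / 3) = c at *
  generalize octaRoot x s t = w at *
  generalize (c + w) ^ (1 / 4 : ℂ) = p at *
  generalize (2 : ℂ) ^ (-1 / 4 : ℂ) = e at *
  generalize octaR x t ^ (1 / 12 : ℂ) = ρ at *
  rw [← hρ]
  convert octaRelation_parametrization (ρ ^ 4 * c) (ρ ^ 4 * (c + w)) using 2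
  · have : (ρ ^ 4 * c) ^ 2 + 6 * (ρ ^ 4 * (c + w)) * (ρ ^ 4 * c) - 3 * (ρ ^ 4 * (c + w)) ^ 2 =
        ρ ^ 8 := by
      linear_combination -ρ ^ 8 * hw
    rw [this]
    ring
  · linear_combination -3 * ρ ^ 12 * c * hw
  · rw [mul_pow, mul_pow, show e ^ 12 = (e ^ 4) ^ 3 by ring, h2,
      show p ^ 12 = (p ^ 4) ^ 3 by ring, hp]
    ring

theorem octaRelation_octaSeries :
    octaRelation (1 - PowerSeries.C (2 * Polynomial.X) * PowerSeries.X + PowerSeries.X ^ 2)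
      (1 - PowerSeries.C Polynomial.X * PowerSeries.X) (8 * octaSeries ^ 12) = 0 := by
  ext1 n
  -- Coefficients are polynomials in `x`, so it suffices to evaluate at each complex `x`, where the
  -- generating function is the Taylor series of the closed form.
  refine Polynomial.funext fun x => ?_
  obtain ⟨s, hs⟩ := IsAlgClosed.exists_pow_nat_eq (x ^ 2 - 1) two_pos
  have hC (a : ℂ) : taylorAtZero (algebraMap ℂ analyticAtZero a) = PowerSeries.C a :=
    taylorAtZero.commutes a
  have h : taylorAtZero (octaRelation (1 - algebraMap ℂ _ (2 * x) * idAtZero + idAtZero ^ 2)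
      (1 - algebraMap ℂ _ x * idAtZero) (8 * octaGerm x s hs ^ 12)) = taylorAtZero 0 := by
    apply taylorAtZero_congr
    filter_upwards [eventually_octaRegular x s] with t ht
    exact ht.octaRelation_octaFun hs
  rw [← AlgHom.coe_toRingHom, map_octaRelation] at h
  simp only [AlgHom.coe_toRingHom, map_add, map_sub, map_mul, map_pow, map_one, map_zero, map_ofNat,
    taylorAtZero_id, hC, taylorAtZero_octaGerm hs] at h
  rw [map_zero, Polynomial.eval_zero, ← Polynomial.coe_evalRingHom, ← PowerSeries.coeff_map,
    map_octaRelation]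
  simp only [map_add, map_sub, map_mul, map_pow, map_one, map_ofNat, PowerSeries.map_C,
    PowerSeries.map_X, Polynomial.coe_evalRingHom, Polynomial.eval_X]
  rw [h, map_zero]

theorem isAlgebraic_octaSeries : IsAlgebraic (Polynomial (Polynomial ℂ)) octaSeries := by
  let q : Polynomial (Polynomial ℂ) :=
    1 - Polynomial.C (2 * Polynomial.X) * Polynomial.X + Polynomial.X ^ 2
  let k : Polynomial (Polynomial ℂ) := 1 - Polynomial.C Polynomial.X * Polynomial.X
  refine ⟨octaRelation (Polynomial.C q) (Polynomial.C k) (8 * Polynomial.X ^ 12), ?_, ?_⟩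
  · intro h
    -- At `Y = 0` the relation is `(q - k ^ 2) ^ 3`, which is `1` at `x = 0`, `t = 1`.
    have h1 := congrArg (fun p => ((p.eval 0).eval 1).eval 0) h
    simp [octaRelation, q, k] at h1
  · have h := map_octaRelation (Polynomial.aeval (R := Polynomial (Polynomial ℂ)) octaSeries
      : _ →ₐ[_] _).toRingHom (Polynomial.C q) (Polynomial.C k) (8 * Polynomial.X ^ 12)
    refine h.trans (Eq.trans ?_ octaRelation_octaSeries)
    have hcoe (p : Polynomial (Polynomial ℂ)) :
        algebraMap (Polynomial (Polynomial ℂ)) (PowerSeries (Polynomial ℂ)) p = p := by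
      rw [PowerSeries.algebraMap_apply', Algebra.algebraMap_self, PowerSeries.map_id]
      rfl
    simp only [AlgHom.toRingHom_eq_coe, RingHom.coe_coe, Polynomial.aeval_C, hcoe, map_mul,
      map_pow, map_ofNat, Polynomial.aeval_X]
    simp only [q, k, Polynomial.coe_add, Polynomial.coe_sub, Polynomial.coe_mul,
      Polynomial.coe_pow, Polynomial.coe_one, Polynomial.coe_C, Polynomial.coe_X]
    rw [map_mul, map_ofNat]

end

theorem mainTheorem4 :
    (∀ x s : ℂ, 1 < ‖x‖ → s ^ 2 = x ^ 2 - 1 →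
      ∃ r : ℝ, 0 < r ∧ ∀ t : ℂ, t ≠ 0 → ‖t‖ < r →
        Complex.exp (octaXi x s t) = (octaR x t)⁻¹ * (1 - (x - s) * t) ∧
        Complex.sinh (octaXi x s t / 3) ≠ 0 ∧
        HasSum
          (fun n : ℕ => pochhammerC (-1 / 12) n / pochhammerC (1 / 2) n *
            (gegenbauerPoly (1 / 4) n).eval x * t ^ n)
          (octaClosedForm x s t)) ∧
    IsAlgebraic (Polynomial (Polynomial ℂ)) octaSeries := by
  refine ⟨fun x s hx hs => ?_, isAlgebraic_octaSeries⟩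
  obtain ⟨r₁, hr₁, hreg⟩ := Metric.eventually_nhds_iff_ball.mp (eventually_octaRegular x s)
  obtain ⟨r₂, hr₂, hsum⟩ := exists_hasSum_taylorAtZero (octaGerm x s hs)
  refine ⟨min r₁ r₂, lt_min hr₁ hr₂, fun t ht htr => ?_⟩
  have h := hreg t (mem_ball_zero_iff.mpr (htr.trans_le (min_le_left _ _)))
  have h0 := sinh_octaXi_div_three_ne_zero hx hs ht h
  refine ⟨h.exp_octaXi, h0, ?_⟩
  rw [octaClosedForm_eq_octaFun h0]
  have h1 : HasSum _ (octaFun x s t) := hsum t (htr.trans_le (min_le_right _ _))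
  rw [taylorAtZero_octaGerm hs] at h1
  simpa [octaSeries, octaCoeff] using h1
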